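/- Let $W$ be a set of worlds with an arbitrary accessibility relation $\prec$ that is converse well-founded (there is no infinite chain $w_0\prec w_1\prec w_2\prec\cdots$); $\prec^+$ is its transitive closure and $\prec^*$ its reflexive transitive closure. Every atomic proposition is intrinsically either positive ($Q^+$) or negative ($Q^-$). Unpolarized propositions are $A,B ::= Q^+\mid Q^-\mid\bot\mid A\supset B\mid\Diamond A\mid\Box A$; polarized propositions are $$A^+ ::= Q^+\mid{\downarrow}A^-\mid\bot\mid\Diamond A^+\mid\Box A^+,\qquad A^-,B^- ::= Q^-\mid{\uparrow}A^+\mid A^+\supset B^-.$$ A context $\Gamma$ is a finite list of judgments $A[w]$ (of judgments $A^+[w]$ in the polarized case). **Natural deduction for CPL\*.** The judgment $\Gamma\vdash A[w]$ is defined one world at a time, by recursion along $\prec$ (provability at all $w'$ with $w\prec^+w'$ is defined before provability at $w$) and, at each world, inductively by the rules: - $\mathit{hyp}$: $\Gamma\vdash A[w]$ if $A[w]\in\Gamma$. - $\bot E$: if $w''\prec^*w$ and $\Gamma\vdash\bot[w]$, then $\Gamma\vdash C[w'']$. - $\supset I$: if $\Gamma,A[w]\vdash B[w]$, then $\Gamma\vdash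 A\supset B[w]$. $\supset E$: if $\Gamma\vdash A\supset B[w]$ and $\Gamma\vdash A[w]$, then $\Gamma\vdash B[w]$. - $\Diamond I$: if $w\prec w'$ and $\Gamma\vdash A[w']$, then $\Gamma\vdash\Diamond A[w]$. $\Box I$: if $\Gamma\vdash A[w']$ for all $w'$ with $w\prec w'$, then $\Gamma\vdash\Box A[w]$. - $\Diamond E$: if $w''\prec^*w$, $\Gamma\vdash\Diamond A[w]$, and for every $w'$ with $w\prec w'$, $\Gamma\vdash A[w']$ implies $\Gamma\vdash C[w'']$, then $\Gamma\vdash C[w'']$. - $\Box E$: if $w''\prec^*w$, $\Gamma\vdash\Box A[w]$, and ($\Gamma\vdash A[w']$ for all $w'$ with $w\prec w'$) implies $\Gamma\vdash C[w'']$, then $\Gamma\vdash C[w'']$. **Focused sequent calculus for CPL\*.** There are right-focus sequents $\Gamma\Rightarrow[A^+[w]]$, inversion sequents $\Gamma;\Omega\Rightarrow C^-[w]$ (where $\Omega$ is empty, written $\cdot$, or a single judgment $A^+[w']$), and left-focus sequents $\Gamma;[A^-[w']]\Rightarrow C^-[w]$. In the sequents with a distinguished left judgment at $w'$, one always has $w\prec^*w'$.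 Provability is again defined one succedent world at a time along $\prec$ and, at each world, inductively. Call $Q^+$ and ${\downarrow}A^-$ stable positive propositions, and $Q^-$ and ${\uparrow}A^+$ stable negative ones. The rules are: - $\Gamma\Rightarrow[Q^+[w]]$ if $Q^+[w]\in\Gamma$; $\Gamma\Rightarrow[{\downarrow}A^-[w]]$ if $\Gamma;\cdot\Rightarrow A^-[w]$; $\Gamma\Rightarrow[\Diamond A^+[w]]$ if $\Gamma;\cdot\Rightarrow{\uparrow}A^+[w']$ for some $w'$ with $w\prec w'$; $\Gamma\Rightarrow[\Box A^+[w]]$ if $\Gamma;\cdot\Rightarrow{\uparrow}A^+[w']$ for all $w'$ with $w\prec w'$. - $\Gamma;\cdot\Rightarrow A^+\supset B^-[w]$ if $\Gamma;A^+[w]\Rightarrow B^-[w]$; $\Gamma;\cdot\Rightarrow{\uparrow}A^+[w]$ if $\Gamma\Rightarrow[A^+[w]]$; $\Gamma;\cdot\Rightarrow C^-[w]$ if $C^-$ is stable, ${\downarrow}A^-[w']\in\Gamma$, $w\prec^*w'$ and $\Gamma;[A^-[w']]\Rightarrow C^-[w]$. - $\Gamma;A^+[w']\Rightarrow C^-[w]$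 if $A^+$ is stable and $\Gamma,A^+[w'];\cdot\Rightarrow C^-[w]$; $\Gamma;\bot[w']\Rightarrow C^-[w]$ always; $\Gamma;\Diamond A^+[w']\Rightarrow C^-[w'']$ if, for every $w$ with $w'\prec w$, $\Gamma;\cdot\Rightarrow{\uparrow}A^+[w]$ implies $\Gamma;\cdot\Rightarrow C^-[w'']$; $\Gamma;\Box A^+[w']\Rightarrow C^-[w'']$ if ($\Gamma;\cdot\Rightarrow{\uparrow}A^+[w]$ for all $w$ with $w'\prec w$) implies $\Gamma;\cdot\Rightarrow C^-[w'']$. - $\Gamma;[Q^-[w]]\Rightarrow Q^-[w]$ always; $\Gamma;[{\uparrow}A^+[w']]\Rightarrow C^-[w]$ if $\Gamma;A^+[w']\Rightarrow C^-[w]$; $\Gamma;[A^+\supset B^-[w']]\Rightarrow C^-[w]$ if $\Gamma\Rightarrow[A^+[w']]$ and $\Gamma;[B^-[w']]\Rightarrow C^-[w]$. **Translation.** Put $(Q^+)^\oplus=Q^+$, $\bot^\oplus=\bot$, $(\Diamond A)^\oplus=\Diamond A^\oplus$, $(\Box A)^\oplus=\Box A^\oplus$, $(Q^-)^\oplus={\downarrow}Q^-$,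 $(A\supset B)^\oplus={\downarrow}(A^\oplus\supset B^\ominus)$; and $(Q^+)^\ominus={\uparrow}Q^+$, $\bot^\ominus={\uparrow}\bot$, $(\Diamond A)^\ominus={\uparrow}\Diamond A^\oplus$, $(\Box A)^\ominus={\uparrow}\Box A^\oplus$, $(Q^-)^\ominus=Q^-$, $(A\supset B)^\ominus=A^\oplus\supset B^\ominus$. The context $\Gamma^\circledcirc$ arises from $\Gamma$ by replacing every $Q^+[w]$ by itself and every other $A[w]$ by ${\downarrow}A^\ominus[w]$. **Theorem (Equivalence).** For all $\Gamma$, $A$ and $w$: $\ \Gamma\vdash A[w]$ in natural deduction for CPL\* if and only if $\Gamma^\circledcirc;\cdot\Rightarrow A^\ominus[w]$ is provable in the focused sequent calculus for CPL\*. -/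

import Mathlib

namespace CPL

universe p n

open Relation

/-- Unpolarized propositions. `P` is the type of (intrinsically) positive atomic propositions and
`N` the type of (intrinsically) negative ones. -/
inductive Form (P N : Type*) where
  | posAtom (Q : P)
  | negAtom (Q : N)
  | bot
  | imp (A B : Form P N)
  | dia (A : Form P N)
  | box (A : Form P N)

mutual
/-- Positive propositions `Q⁺ | ↓A⁻ | ⊥ | ◇A⁺ | □A⁺`. -/
inductive Pos (P : Type p) (N : Type n) where
  | atom (Q : P)
  | down (A : Neg P N)
  | bot
  | dia (A : Pos P N)
  | box (A : Pos P N)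
/-- Negative propositions `Q⁻ | ↑A⁺ | A⁺ ⊃ B⁻`. -/
inductive Neg (P : Type p) (N : Type n) where
  | atom (Q : N)
  | up (A : Pos P N)
  | imp (A : Pos P N) (B : Neg P N)
end

section Translation
variable {P N W : Type*}

mutual
/-- The translation `A ↦ A^⊕`. -/
def Form.toPos : Form P N → Pos P N
  | .posAtom Q => .atom Q
  | .negAtom Q => .down (.atom Q)
  | .bot => .bot
  | .imp A B => .down (.imp A.toPos B.toNeg)
  | .dia A => .dia A.toPos
  | .box A => .box A.toPos
/-- The translation `A ↦ A^⊖`. -/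
def Form.toNeg : Form P N → Neg P N
  | .posAtom Q => .up (.atom Q)
  | .negAtom Q => .atom Q
  | .bot => .up .bot
  | .imp A B => .imp A.toPos B.toNeg
  | .dia A => .up (.dia A.toPos)
  | .box A => .up (.box A.toPos)
end

/-- The translation of a single hypothesis. -/
def Form.toHyp : Form P N → Pos P N
  | .posAtom Q => .atom Q
  | .negAtom Q => .down (.atom Q)
  | .bot => .down (.up .bot)
  | .imp A B => .down (.imp A.toPos B.toNeg)
  | .dia A => .down (.up (.dia A.toPos))
  | .box A => .down (.up (.box A.toPos))

/-- The translation `Γ ↦ Γ^⊚` of contexts; the pair `(A, w)` stands for the judgment `A[w]`. -/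
def polCtx (Γ : List (Form P N × W)) : List (Pos P N × W) :=
  Γ.map fun h => (h.1.toHyp, h.2)

/-- `A⁺ stable⁺`. -/
inductive Pos.Stable : Pos P N → Prop
  | atom (Q : P) : Pos.Stable (.atom Q)
  | down (A : Neg P N) : Pos.Stable (.down A)

/-- `A⁻ stable⁻`. -/
inductive Neg.Stable : Neg P N → Prop
  | atom (Q : N) : Neg.Stable (.atom Q)
  | up (A : Pos P N) : Neg.Stable (.up A)

end Translation

variable {P N W : Type*}

/-- If accessibility is converse well-founded, then so is its transitive closure. -/
theorem wf_transGen {acc : W → W → Prop} (hwf : WellFounded fun u v => acc v u) :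
    WellFounded fun u v => TransGen acc v u := by
  have h : (fun u v => TransGen acc v u) = TransGen fun u v => acc v u := by
    funext u v
    exact propext (transGen_swap (r := acc) (a := u) (b := v)).symm
  rw [h]
  exact hwf.transGen

/-! ### Natural deduction

Provability is defined one world at a time, by recursion along the converse well-founded
accessibility relation. -/

/-- The rules with conclusion at the world `w`, when provability at the worlds transitively
accessible from `w` is already given by `earlier`. `NDLayer acc earlier w v Γ A` is `Γ ⊢ A[v]`,
where `v` is `w` (and the last step is one of the rules) or a world to which `earlier` applies.
Only in premises of premises, where the rules reflect over provability, does `earlier` replace the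
judgment itself. -/
inductive NDLayer (acc : W → W → Prop) (earlier : W → List (Form P N × W) → Form P N → Prop)
    (w : W) : W → List (Form P N × W) → Form P N → Prop
  | earlier {v : W} {Γ : List (Form P N × W)} {A : Form P N} :
      earlier v Γ A → NDLayer acc earlier w v Γ A
  | hyp {Γ : List (Form P N × W)} {A : Form P N} :
      (A, w) ∈ Γ → NDLayer acc earlier w w Γ A
  | botE {v : W} {Γ : List (Form P N × W)} {C : Form P N} :
      ReflTransGen acc w v → NDLayer acc earlier w v Γ .bot → NDLayer acc earlier w w Γ C
  | impI {Γ : List (Form P N × W)} {A B : Form P N} :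
      NDLayer acc earlier w w ((A, w) :: Γ) B → NDLayer acc earlier w w Γ (.imp A B)
  | impE {Γ : List (Form P N × W)} {A B : Form P N} :
      NDLayer acc earlier w w Γ (.imp A B) → NDLayer acc earlier w w Γ A →
      NDLayer acc earlier w w Γ B
  | diaI {u : W} {Γ : List (Form P N × W)} {A : Form P N} :
      acc w u → NDLayer acc earlier w u Γ A → NDLayer acc earlier w w Γ (.dia A)
  | boxI {Γ : List (Form P N × W)} {A : Form P N} :
      (∀ u, acc w u → NDLayer acc earlier w u Γ A) → NDLayer acc earlier w w Γ (.box A)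
  | diaE {v : W} {Γ : List (Form P N × W)} {A C : Form P N} :
      ReflTransGen acc w v → NDLayer acc earlier w v Γ (.dia A) →
      (∀ u, acc v u → earlier u Γ A → NDLayer acc earlier w w Γ C) →
      NDLayer acc earlier w w Γ C
  | boxE {v : W} {Γ : List (Form P N × W)} {A C : Form P N} :
      ReflTransGen acc w v → NDLayer acc earlier w v Γ (.box A) →
      ((∀ u, acc v u → earlier u Γ A) → NDLayer acc earlier w w Γ C) →
      NDLayer acc earlier w w Γ C

/-- `ND acc hwf w Γ A` is the natural deduction judgment `Γ ⊢ A[w]` of CPL*. -/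
noncomputable def ND (acc : W → W → Prop) (hwf : WellFounded fun u v => acc v u) :
    W → List (Form P N × W) → Form P N → Prop :=
  (wf_transGen hwf).fix fun w ih =>
    NDLayer acc (fun v Γ A => ∃ h : TransGen acc w v, ih v h Γ A) w w

/-- The recursive characterization of `ND`. -/
theorem nd_eq (acc : W → W → Prop) (hwf : WellFounded fun u v => acc v u) (w : W) :
    ND (P := P) (N := N) acc hwf w =
      NDLayer acc (fun v Γ A => TransGen acc w v ∧ ND acc hwf v Γ A) w w := by
  unfold ND
  rw [WellFounded.fix_eq]
  simp only [exists_prop]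

/-! ### The focused sequent calculus -/

/-- The part of a focused sequent other than its context `Γ` and the world `w` of its succedent:
`rfoc A` for `Γ ⟹ [A⁺[w]]` (right focus), `inv Ω C` for `Γ; Ω ⟹ C⁻[w]` (inversion; `Ω` is empty or
a single `A⁺[v]`), and `lfoc A v C` for `Γ; [A⁻[v]] ⟹ C⁻[w]` (left focus on `A⁻[v]`). -/
inductive Goal (P N W : Type*) where
  | rfoc (A : Pos P N)
  | inv (Ω : Option (Pos P N × W)) (C : Neg P N)
  | lfoc (A : Neg P N) (v : W) (C : Neg P N)

/-- The rules with succedent at the world `w`, when provability of sequents with succedent at the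
worlds transitively accessible from `w` is already given by `earlier`; see `NDLayer`.
In all sequents that are met in searching for a proof of a sequent with empty inversion context,
the world `v` of the proposition in left focus or in the inversion context satisfies `w ≺* v`.
This condition is made explicit in `diaL` and `boxL`, where it is what makes the reflection over
provability at the worlds accessible from `v` meaningful. -/
inductive FocLayer (acc : W → W → Prop)
    (earlier : W → List (Pos P N × W) → Goal P N W → Prop)
    (w : W) : W → List (Pos P N × W) → Goal P N W → Prop
  | earlier {v : W} {Γ : List (Pos P N × W)} {S : Goal P N W} :
      earlier v Γ S → FocLayer acc earlier w v Γ S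
  -- right focus
  | atomR {Γ : List (Pos P N × W)} {Q : P} :
      (.atom Q, w) ∈ Γ → FocLayer acc earlier w w Γ (.rfoc (.atom Q))
  | downR {Γ : List (Pos P N × W)} {A : Neg P N} :
      FocLayer acc earlier w w Γ (.inv none A) → FocLayer acc earlier w w Γ (.rfoc (.down A))
  | diaR {u : W} {Γ : List (Pos P N × W)} {A : Pos P N} :
      acc w u → FocLayer acc earlier w u Γ (.inv none (.up A)) →
      FocLayer acc earlier w w Γ (.rfoc (.dia A))
  | boxR {Γ : List (Pos P N × W)} {A : Pos P N} :
      (∀ u, acc w u → FocLayer acc earlier w u Γ (.inv none (.up A))) →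
      FocLayer acc earlier w w Γ (.rfoc (.box A))
  -- inversion
  | impR {Γ : List (Pos P N × W)} {A : Pos P N} {B : Neg P N} :
      FocLayer acc earlier w w Γ (.inv (some (A, w)) B) →
      FocLayer acc earlier w w Γ (.inv none (.imp A B))
  | stableL {v : W} {Γ : List (Pos P N × W)} {A : Pos P N} {C : Neg P N} :
      A.Stable → FocLayer acc earlier w w ((A, v) :: Γ) (.inv none C) →
      FocLayer acc earlier w w Γ (.inv (some (A, v)) C)
  | downL {v : W} {Γ : List (Pos P N × W)} {A C : Neg P N} :
      (.down A, v) ∈ Γ → C.Stable → ReflTransGen acc w v →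
      FocLayer acc earlier w w Γ (.lfoc A v C) → FocLayer acc earlier w w Γ (.inv none C)
  | botL {v : W} {Γ : List (Pos P N × W)} {C : Neg P N} :
      FocLayer acc earlier w w Γ (.inv (some (.bot, v)) C)
  | diaL {v : W} {Γ : List (Pos P N × W)} {A : Pos P N} {C : Neg P N} :
      ReflTransGen acc w v →
      (∀ u, acc v u → earlier u Γ (.inv none (.up A)) →
        FocLayer acc earlier w w Γ (.inv none C)) →
      FocLayer acc earlier w w Γ (.inv (some (.dia A, v)) C)
  | boxL {v : W} {Γ : List (Pos P N × W)} {A : Pos P N} {C : Neg P N} :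
      ReflTransGen acc w v →
      ((∀ u, acc v u → earlier u Γ (.inv none (.up A))) →
        FocLayer acc earlier w w Γ (.inv none C)) →
      FocLayer acc earlier w w Γ (.inv (some (.box A, v)) C)
  | upR {Γ : List (Pos P N × W)} {A : Pos P N} :
      FocLayer acc earlier w w Γ (.rfoc A) → FocLayer acc earlier w w Γ (.inv none (.up A))
  -- left focus
  | atomL {Γ : List (Pos P N × W)} {Q : N} :
      FocLayer acc earlier w w Γ (.lfoc (.atom Q) w (.atom Q))
  | upL {v : W} {Γ : List (Pos P N × W)} {A : Pos P N} {C : Neg P N} :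
      FocLayer acc earlier w w Γ (.inv (some (A, v)) C) →
      FocLayer acc earlier w w Γ (.lfoc (.up A) v C)
  | impL {v : W} {Γ : List (Pos P N × W)} {A : Pos P N} {B C : Neg P N} :
      FocLayer acc earlier w v Γ (.rfoc A) → FocLayer acc earlier w w Γ (.lfoc B v C) →
      FocLayer acc earlier w w Γ (.lfoc (.imp A B) v C)

/-- `Foc acc hwf w Γ S` says that the focused sequent given by `Γ`, `S` and the succedent's world
`w` is provable in the focused sequent calculus of CPL*. -/
noncomputable def Foc (acc : W → W → Prop) (hwf : WellFounded fun u v => acc v u) :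
    W → List (Pos P N × W) → Goal P N W → Prop :=
  (wf_transGen hwf).fix fun w ih =>
    FocLayer acc (fun v Γ S => ∃ h : TransGen acc w v, ih v h Γ S) w w

/-- The recursive characterization of `Foc`. -/
theorem foc_eq (acc : W → W → Prop) (hwf : WellFounded fun u v => acc v u) (w : W) :
    Foc (P := P) (N := N) acc hwf w =
      FocLayer acc (fun v Γ S => TransGen acc w v ∧ Foc acc hwf v Γ S) w w := by
  unfold Foc
  rw [WellFounded.fix_eq]
  simp only [exists_prop]

end CPL

namespace CPL

open Relation

-- Natural deduction: rules and induction at one world.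

section NaturalDeduction

variable {P N W : Type*} {acc : W → W → Prop} {hwf : WellFounded fun u v => acc v u}

-- Erasing polarities turns the translated judgment back into the original one, and translated
-- contexts consist of stable propositions. It therefore suffices to prove, for every stable context
-- and every negative proposition, that focused provability coincides with natural deduction after
-- erasure. This is `FocusingAt`, proved by well-founded induction on the world `w`, assuming it at
-- all worlds strictly above.
--
-- The reflective rules use provability above `w` contravariantly, so the calculi must agree there
-- in both directions, and weakening at `w` is available only when provability above `w` is
-- unchanged (`AgreeAbove`). Two kinds of new hypothesis are harmless: one at `w` itself, since
-- converse well-foundedness makes `w` unreachable from above, and one that is already provable.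
--
-- Soundness is an induction on focused proofs, `Foc.sound_of_above`. Completeness is normalization
-- by evaluation. The states of a Kripke model at `w` are stable contexts, ordered by extensions
-- that keep provability above `w`; positive connectives are interpreted through continuations
-- (`Cover`), and modalities by natural deduction above `w`. Natural deduction is sound in this
-- model (`ND.forces`), and `Pos.reify_reflect` and `Neg.reify_reflect` turn forcing into focused
-- proofs. An elimination whose major premise lies strictly above `w` is handled by `Foc.transport`,
-- which replays the left rules of a focused proof of that premise with a succedent at `w`.

theorem not_transGen_self (hwf : WellFounded fun u v => acc v u) (w : W) :
    ¬ TransGen acc w w := fun h =>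
  (wf_transGen hwf).irrefl.irrefl w h

theorem nd_iff_layer {w : W} {Γ : List (Form P N × W)} {A : Form P N} :
    ND acc hwf w Γ A ↔
      NDLayer acc (fun v Γ A => TransGen acc w v ∧ ND acc hwf v Γ A) w w Γ A := by
  rw [nd_eq]

theorem ND.toLayer {w v : W} {Γ : List (Form P N × W)} {A : Form P N}
    (hv : ReflTransGen acc w v) (h : ND acc hwf v Γ A) :
    NDLayer acc (fun v Γ A => TransGen acc w v ∧ ND acc hwf v Γ A) w v Γ A := by
  rcases reflTransGen_iff_eq_or_transGen.1 hv with rfl | hv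
  · exact nd_iff_layer.1 h
  · exact .earlier ⟨hv, h⟩

theorem ND.hyp {w : W} {Γ : List (Form P N × W)} {A : Form P N} (h : (A, w) ∈ Γ) :
    ND acc hwf w Γ A :=
  nd_iff_layer.2 (.hyp h)

theorem ND.botE {w v : W} {Γ : List (Form P N × W)} {C : Form P N}
    (hv : ReflTransGen acc w v) (h : ND acc hwf v Γ .bot) : ND acc hwf w Γ C :=
  nd_iff_layer.2 (.botE hv (h.toLayer hv))

theorem ND.impI {w : W} {Γ : List (Form P N × W)} {A B : Form P N}
    (h : ND acc hwf w ((A, w) :: Γ) B) : ND acc hwf w Γ (.imp A B) :=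
  nd_iff_layer.2 (.impI (nd_iff_layer.1 h))

theorem ND.impE {w : W} {Γ : List (Form P N × W)} {A B : Form P N}
    (h : ND acc hwf w Γ (.imp A B)) (h' : ND acc hwf w Γ A) : ND acc hwf w Γ B :=
  nd_iff_layer.2 (.impE (nd_iff_layer.1 h) (nd_iff_layer.1 h'))

theorem ND.diaI {w u : W} {Γ : List (Form P N × W)} {A : Form P N}
    (hu : acc w u) (h : ND acc hwf u Γ A) : ND acc hwf w Γ (.dia A) :=
  nd_iff_layer.2 (.diaI hu (h.toLayer (.single hu)))

theorem ND.boxI {w : W} {Γ : List (Form P N × W)} {A : Form P N}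
    (h : ∀ u, acc w u → ND acc hwf u Γ A) : ND acc hwf w Γ (.box A) :=
  nd_iff_layer.2 (.boxI fun u hu => (h u hu).toLayer (.single hu))

theorem ND.diaE {w v : W} {Γ : List (Form P N × W)} {A C : Form P N}
    (hv : ReflTransGen acc w v) (h : ND acc hwf v Γ (.dia A))
    (k : ∀ u, acc v u → ND acc hwf u Γ A → ND acc hwf w Γ C) : ND acc hwf w Γ C :=
  nd_iff_layer.2 (.diaE hv (h.toLayer hv) fun u hu h' => nd_iff_layer.1 (k u hu h'.2))

theorem ND.boxE {w v : W} {Γ : List (Form P N × W)} {A C : Form P N}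
    (hv : ReflTransGen acc w v) (h : ND acc hwf v Γ (.box A))
    (k : (∀ u, acc v u → ND acc hwf u Γ A) → ND acc hwf w Γ C) : ND acc hwf w Γ C :=
  nd_iff_layer.2 (.boxE hv (h.toLayer hv) fun h' => nd_iff_layer.1 (k fun u hu => (h' u hu).2))

/-- Induction on natural deductions with conclusion at the fixed world `w`. -/
theorem ND.induct {w : W} {motive : List (Form P N × W) → Form P N → Prop}
    (hyp : ∀ {Γ A}, (A, w) ∈ Γ → motive Γ A)
    (botE : ∀ {v Γ C}, ReflTransGen acc w v → ND acc hwf v Γ .bot →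
      (v = w → motive Γ .bot) → motive Γ C)
    (impI : ∀ {Γ A B}, motive ((A, w) :: Γ) B → motive Γ (.imp A B))
    (impE : ∀ {Γ A B}, motive Γ (.imp A B) → motive Γ A → motive Γ B)
    (diaI : ∀ {u Γ A}, acc w u → ND acc hwf u Γ A → motive Γ (.dia A))
    (boxI : ∀ {Γ A}, (∀ u, acc w u → ND acc hwf u Γ A) → motive Γ (.box A))
    (diaE : ∀ {v Γ A C}, ReflTransGen acc w v → ND acc hwf v Γ (.dia A) →
      (v = w → motive Γ (.dia A)) →
      (∀ u, acc v u → ND acc hwf u Γ A → motive Γ C) → motive Γ C)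
    (boxE : ∀ {v Γ A C}, ReflTransGen acc w v → ND acc hwf v Γ (.box A) →
      (v = w → motive Γ (.box A)) →
      ((∀ u, acc v u → ND acc hwf u Γ A) → motive Γ C) → motive Γ C)
    {Γ : List (Form P N × W)} {A : Form P N} (h : ND acc hwf w Γ A) : motive Γ A := by
  -- The layer also contains judgments at worlds above `w`. For these only true provability is
  -- carried along; the motive is claimed at `w` alone, where `earlier` is excluded by
  -- irreflexivity.
  suffices H : ∀ v Γ A,
      NDLayer acc (fun v Γ A => TransGen acc w v ∧ ND acc hwf v Γ A) w v Γ A →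
      ND acc hwf v Γ A ∧ (v = w → motive Γ A) from
    (H w Γ A (nd_iff_layer.1 h)).2 rfl
  intro v Γ A h
  induction h with
  | earlier h =>
    refine ⟨h.2, ?_⟩
    rintro rfl
    exact (not_transGen_self hwf _ h.1).elim
  | hyp h => exact ⟨.hyp h, fun _ => hyp h⟩
  | botE hv _ ih => exact ⟨.botE hv ih.1, fun _ => botE hv ih.1 ih.2⟩
  | impI _ ih => exact ⟨.impI ih.1, fun _ => impI (ih.2 rfl)⟩
  | impE _ _ ih ih' => exact ⟨.impE ih.1 ih'.1, fun _ => impE (ih.2 rfl) (ih'.2 rfl)⟩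
  | diaI hu _ ih => exact ⟨.diaI hu ih.1, fun _ => diaI hu ih.1⟩
  | boxI _ ih =>
    exact ⟨.boxI fun u hu => (ih u hu).1, fun _ => boxI fun u hu => (ih u hu).1⟩
  | diaE hv _ _ ih ihk =>
    exact ⟨.diaE hv ih.1 fun u hu h => (ihk u hu ⟨.tail' hv hu, h⟩).1,
      fun _ => diaE hv ih.1 ih.2 fun u hu h => (ihk u hu ⟨.tail' hv hu, h⟩).2 rfl⟩
  | boxE hv _ _ ih ihk =>
    exact ⟨.boxE hv ih.1 fun h => (ihk fun u hu => ⟨.tail' hv hu, h u hu⟩).1,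
      fun _ => boxE hv ih.1 ih.2 fun h => (ihk fun u hu => ⟨.tail' hv hu, h u hu⟩).2 rfl⟩

-- Agreement above a world, weakening and substitution.

/-- The two contexts prove the same at all worlds transitively accessible from `w`. -/
def AgreeAbove (acc : W → W → Prop) (hwf : WellFounded fun u v => acc v u) (w : W)
    (Γ Δ : List (Form P N × W)) : Prop :=
  ∀ u, TransGen acc w u → ∀ A, ND acc hwf u Γ A ↔ ND acc hwf u Δ A

theorem AgreeAbove.refl (w : W) (Γ : List (Form P N × W)) : AgreeAbove acc hwf w Γ Γ :=
  fun _ _ _ => Iff.rfl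

theorem AgreeAbove.symm {w : W} {Γ Δ : List (Form P N × W)} (h : AgreeAbove acc hwf w Γ Δ) :
    AgreeAbove acc hwf w Δ Γ :=
  fun u hu A => (h u hu A).symm

theorem AgreeAbove.trans {w : W} {Γ Δ Θ : List (Form P N × W)}
    (h : AgreeAbove acc hwf w Γ Δ) (h' : AgreeAbove acc hwf w Δ Θ) :
    AgreeAbove acc hwf w Γ Θ :=
  fun u hu A => (h u hu A).trans (h' u hu A)

/-- Only hypotheses at worlds reachable from `w` matter at `w`. -/
theorem ND.of_agree_reachable {w : W} {Γ Δ : List (Form P N × W)} {C : Form P N}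
    (hΓ : ∀ u, ReflTransGen acc w u → ∀ A, (A, u) ∈ Γ ↔ (A, u) ∈ Δ)
    (h : ND acc hwf w Γ C) : ND acc hwf w Δ C := by
  induction w using (wf_transGen hwf).induction generalizing Γ Δ C with
  | _ w IH =>
  have up : ∀ {Γ Δ : List (Form P N × W)} {v C},
      (∀ u, ReflTransGen acc w u → ∀ A, (A, u) ∈ Γ ↔ (A, u) ∈ Δ) →
      TransGen acc w v → ND acc hwf v Γ C → ND acc hwf v Δ C := fun hΓ hv h =>
    IH _ hv (fun u hu => hΓ u (hv.to_reflTransGen.trans hu)) h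
  have pre : ∀ {Γ Δ : List (Form P N × W)} {v C},
      (∀ u, ReflTransGen acc w u → ∀ A, (A, u) ∈ Γ ↔ (A, u) ∈ Δ) →
      ReflTransGen acc w v → ND acc hwf v Γ C →
      (v = w → ∀ Δ, (∀ u, ReflTransGen acc w u → ∀ A, (A, u) ∈ Γ ↔ (A, u) ∈ Δ) →
        ND acc hwf w Δ C) → ND acc hwf v Δ C := by
    intro Γ Δ v C hΓ hv h ih
    rcases reflTransGen_iff_eq_or_transGen.1 hv with rfl | hv
    · exact ih rfl Δ hΓ
    · exact up hΓ hv h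
  -- The continuations of `diaE` and `boxE` receive provability from the new context and must return
  -- it to the old one, hence the symmetric form.
  have sym : ∀ {Γ Δ : List (Form P N × W)},
      (∀ u, ReflTransGen acc w u → ∀ A, (A, u) ∈ Γ ↔ (A, u) ∈ Δ) →
      (∀ u, ReflTransGen acc w u → ∀ A, (A, u) ∈ Δ ↔ (A, u) ∈ Γ) :=
    fun h u hu A => (h u hu A).symm
  refine ND.induct (motive := fun Γ C => ∀ Δ, (∀ u, ReflTransGen acc w u →
    ∀ A, (A, u) ∈ Γ ↔ (A, u) ∈ Δ) → ND acc hwf w Δ C) ?_ ?_ ?_ ?_ ?_ ?_ ?_ ?_ h Δ hΓ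
  · exact fun h Δ hΓ => .hyp ((hΓ w .refl _).1 h)
  · exact fun hv h ih Δ hΓ => .botE hv (pre hΓ hv h ih)
  · refine fun ih Δ hΓ => .impI (ih _ fun u hu A => ?_)
    simp only [List.mem_cons, hΓ u hu A]
  · exact fun ih ih' Δ hΓ => .impE (ih Δ hΓ) (ih' Δ hΓ)
  · exact fun hu h Δ hΓ => .diaI hu (up hΓ (.single hu) h)
  · exact fun h Δ hΓ => .boxI fun u hu => up hΓ (.single hu) (h u hu)
  · exact fun hv h ih k Δ hΓ => .diaE hv (pre hΓ hv h ih) fun u hu h' =>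
      k u hu (up (sym hΓ) (.tail' hv hu) h') Δ hΓ
  · exact fun hv h ih k Δ hΓ => .boxE hv (pre hΓ hv h ih) fun h' =>
      k (fun u hu => up (sym hΓ) (.tail' hv hu) (h' u hu)) Δ hΓ

/-- No world strictly above `w` can reach `w` again, so a hypothesis at `w` is irrelevant there. -/
theorem AgreeAbove.cons_self (w : W) (A : Form P N) (Γ : List (Form P N × W)) :
    AgreeAbove acc hwf w ((A, w) :: Γ) Γ := by
  intro u hu B
  have key : ∀ v, ReflTransGen acc u v → ∀ B, (B, v) ∈ (A, w) :: Γ ↔ (B, v) ∈ Γ := by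
    intro v hv B
    have : v ≠ w := by
      rintro rfl
      exact not_transGen_self hwf _ (hu.trans_left hv)
    simp [this]
  exact ⟨.of_agree_reachable key, .of_agree_reachable fun v hv B => (key v hv B).symm⟩

/-- Substitution of deductions at `w` for the hypotheses at `w`, for contexts closed under a
weakening property `R`. -/
theorem ND.subst_aux {w : W} {R : List (Form P N × W) → List (Form P N × W) → Prop}
    (agree : ∀ {Γ Δ}, R Γ Δ → AgreeAbove acc hwf w Γ Δ)
    (hyps : ∀ {Γ Δ A}, R Γ Δ → (A, w) ∈ Γ → ND acc hwf w Δ A)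
    (cons : ∀ {Γ Δ A}, R Γ Δ → R ((A, w) :: Γ) ((A, w) :: Δ))
    {Γ Δ : List (Form P N × W)} {C : Form P N} (hΓ : R Γ Δ) (h : ND acc hwf w Γ C) :
    ND acc hwf w Δ C := by
  have pre : ∀ {Γ Δ : List (Form P N × W)} {v C}, R Γ Δ →
      ReflTransGen acc w v → ND acc hwf v Γ C →
      (v = w → ∀ Δ, R Γ Δ → ND acc hwf w Δ C) → ND acc hwf v Δ C := by
    intro Γ Δ v C hΓ hv h ih
    rcases reflTransGen_iff_eq_or_transGen.1 hv with rfl | hv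
    · exact ih rfl Δ hΓ
    · exact (agree hΓ v hv C).1 h
  refine ND.induct (motive := fun Γ C => ∀ Δ, R Γ Δ → ND acc hwf w Δ C)
    ?_ ?_ ?_ ?_ ?_ ?_ ?_ ?_ h Δ hΓ
  · exact fun h Δ hΓ => hyps hΓ h
  · exact fun hv h ih Δ hΓ => .botE hv (pre hΓ hv h ih)
  · exact fun ih Δ hΓ => .impI (ih _ (cons hΓ))
  · exact fun ih ih' Δ hΓ => .impE (ih Δ hΓ) (ih' Δ hΓ)
  · exact fun hu h Δ hΓ => .diaI hu ((agree hΓ _ (.single hu) _).1 h)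
  · exact fun h Δ hΓ => .boxI fun u hu => (agree hΓ _ (.single hu) _).1 (h u hu)
  -- The continuation is given provability from `Δ` but expects it from `Γ`: agreement is used from
  -- right to left.
  · exact fun hv h ih k Δ hΓ => .diaE hv (pre hΓ hv h ih) fun u hu h' =>
      k u hu ((agree hΓ u (.tail' hv hu) _).2 h') Δ hΓ
  · exact fun hv h ih k Δ hΓ => .boxE hv (pre hΓ hv h ih) fun h' =>
      k (fun u hu => (agree hΓ u (.tail' hv hu) _).2 (h' u hu)) Δ hΓ

theorem AgreeAbove.cons_cons {w : W} {Γ Δ : List (Form P N × W)}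
    (h : AgreeAbove acc hwf w Γ Δ) (A : Form P N) :
    AgreeAbove acc hwf w ((A, w) :: Γ) ((A, w) :: Δ) :=
  ((AgreeAbove.cons_self w A Γ).trans h).trans (AgreeAbove.cons_self w A Δ).symm

/-- Inclusion alone would not suffice: new hypotheses at higher worlds may make more provable there,
and reflective premises would then have more cases to answer. -/
theorem ND.weaken {w : W} {Γ Δ : List (Form P N × W)} {C : Form P N}
    (agree : AgreeAbove acc hwf w Γ Δ) (sub : ∀ A, (A, w) ∈ Γ → (A, w) ∈ Δ)
    (h : ND acc hwf w Γ C) : ND acc hwf w Δ C := by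
  refine ND.subst_aux (R := fun Γ Δ => AgreeAbove acc hwf w Γ Δ ∧
    ∀ A, (A, w) ∈ Γ → (A, w) ∈ Δ) (fun h => h.1) (fun h hA => .hyp (h.2 _ hA)) ?_ ⟨agree, sub⟩ h
  refine fun {Γ Δ A} h => ⟨h.1.cons_cons A, fun B hB => ?_⟩
  rcases List.mem_cons.1 hB with hB | hB
  · exact List.mem_cons.2 (.inl hB)
  · exact List.mem_cons.2 (.inr (h.2 B hB))

theorem ND.weaken_cons {w : W} {Γ : List (Form P N × W)} {A C : Form P N}
    (h : ND acc hwf w Γ C) : ND acc hwf w ((A, w) :: Γ) C :=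
  h.weaken (AgreeAbove.cons_self w A Γ).symm fun _ hB => List.mem_cons_of_mem _ hB

theorem ND.subst {w : W} {Γ Δ : List (Form P N × W)} {C : Form P N}
    (agree : AgreeAbove acc hwf w Γ Δ) (hyps : ∀ A, (A, w) ∈ Γ → ND acc hwf w Δ A)
    (h : ND acc hwf w Γ C) : ND acc hwf w Δ C := by
  refine ND.subst_aux (R := fun Γ Δ => AgreeAbove acc hwf w Γ Δ ∧
    ∀ A, (A, w) ∈ Γ → ND acc hwf w Δ A) (fun h => h.1) (fun h hA => h.2 _ hA) ?_ ⟨agree, hyps⟩ h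
  refine fun {Γ Δ A} h => ⟨h.1.cons_cons A, fun B hB => ?_⟩
  rcases List.mem_cons.1 hB with hB | hB
  · exact .hyp (List.mem_cons.2 (.inl hB))
  · exact (h.2 B hB).weaken_cons

/-- Adding a provable hypothesis changes provability at no world. -/
theorem ND.cons_iff {v : W} {Γ : List (Form P N × W)} {A : Form P N} (h : ND acc hwf v Γ A)
    (u : W) (C : Form P N) : ND acc hwf u ((A, v) :: Γ) C ↔ ND acc hwf u Γ C := by
  induction u using (wf_transGen hwf).induction generalizing C with
  | _ u IH =>
  -- The induction hypothesis is exactly agreement above `u`, so substitution and weakening apply at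
  -- `u`; the added hypothesis needs replacing only if `u = v`.
  have agree : AgreeAbove acc hwf u ((A, v) :: Γ) Γ := fun u' hu' C => IH u' hu' C
  refine ⟨.subst agree fun B hB => ?_,
    .weaken agree.symm fun B hB => List.mem_cons_of_mem _ hB⟩
  rcases List.mem_cons.1 hB with hB | hB
  · cases hB
    exact h
  · exact .hyp hB

end NaturalDeduction

-- Focused calculus: rules, induction and inversion of right focus.

section Focusing

universe p n

variable {P : Type p} {N : Type n} {W : Type*} {acc : W → W → Prop}
  {hwf : WellFounded fun u v => acc v u}

theorem foc_iff_layer {w : W} {Γ : List (Pos P N × W)} {S : Goal P N W} :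
    Foc acc hwf w Γ S ↔
      FocLayer acc (fun v Γ S => TransGen acc w v ∧ Foc acc hwf v Γ S) w w Γ S := by
  rw [foc_eq]

theorem Foc.toLayer {w v : W} {Γ : List (Pos P N × W)} {S : Goal P N W}
    (hv : ReflTransGen acc w v) (h : Foc acc hwf v Γ S) :
    FocLayer acc (fun v Γ S => TransGen acc w v ∧ Foc acc hwf v Γ S) w v Γ S := by
  rcases reflTransGen_iff_eq_or_transGen.1 hv with rfl | hv
  · exact foc_iff_layer.1 h
  · exact .earlier ⟨hv, h⟩

theorem Foc.atomR {w : W} {Γ : List (Pos P N × W)} {Q : P} (h : (.atom Q, w) ∈ Γ) :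
    Foc acc hwf w Γ (.rfoc (.atom Q)) :=
  foc_iff_layer.2 (.atomR h)

theorem Foc.downR {w : W} {Γ : List (Pos P N × W)} {A : Neg P N}
    (h : Foc acc hwf w Γ (.inv none A)) : Foc acc hwf w Γ (.rfoc (.down A)) :=
  foc_iff_layer.2 (.downR (foc_iff_layer.1 h))

theorem Foc.diaR {w u : W} {Γ : List (Pos P N × W)} {A : Pos P N} (hu : acc w u)
    (h : Foc acc hwf u Γ (.inv none (.up A))) : Foc acc hwf w Γ (.rfoc (.dia A)) :=
  foc_iff_layer.2 (.diaR hu (h.toLayer (.single hu)))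

theorem Foc.boxR {w : W} {Γ : List (Pos P N × W)} {A : Pos P N}
    (h : ∀ u, acc w u → Foc acc hwf u Γ (.inv none (.up A))) :
    Foc acc hwf w Γ (.rfoc (.box A)) :=
  foc_iff_layer.2 (.boxR fun u hu => (h u hu).toLayer (.single hu))

theorem Foc.impR {w : W} {Γ : List (Pos P N × W)} {A : Pos P N} {B : Neg P N}
    (h : Foc acc hwf w Γ (.inv (some (A, w)) B)) : Foc acc hwf w Γ (.inv none (.imp A B)) :=
  foc_iff_layer.2 (.impR (foc_iff_layer.1 h))

theorem Foc.stableL {w v : W} {Γ : List (Pos P N × W)} {A : Pos P N} {C : Neg P N}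
    (hA : A.Stable) (h : Foc acc hwf w ((A, v) :: Γ) (.inv none C)) :
    Foc acc hwf w Γ (.inv (some (A, v)) C) :=
  foc_iff_layer.2 (.stableL hA (foc_iff_layer.1 h))

theorem Foc.downL {w v : W} {Γ : List (Pos P N × W)} {A C : Neg P N}
    (hA : (.down A, v) ∈ Γ) (hC : C.Stable) (hv : ReflTransGen acc w v)
    (h : Foc acc hwf w Γ (.lfoc A v C)) : Foc acc hwf w Γ (.inv none C) :=
  foc_iff_layer.2 (.downL hA hC hv (foc_iff_layer.1 h))

theorem Foc.botL {w v : W} {Γ : List (Pos P N × W)} {C : Neg P N} :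
    Foc acc hwf w Γ (.inv (some (.bot, v)) C) :=
  foc_iff_layer.2 .botL

theorem Foc.diaL {w v : W} {Γ : List (Pos P N × W)} {A : Pos P N} {C : Neg P N}
    (hv : ReflTransGen acc w v)
    (k : ∀ u, acc v u → Foc acc hwf u Γ (.inv none (.up A)) → Foc acc hwf w Γ (.inv none C)) :
    Foc acc hwf w Γ (.inv (some (.dia A, v)) C) :=
  foc_iff_layer.2 (.diaL hv fun u hu h => foc_iff_layer.1 (k u hu h.2))

theorem Foc.boxL {w v : W} {Γ : List (Pos P N × W)} {A : Pos P N} {C : Neg P N}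
    (hv : ReflTransGen acc w v)
    (k : (∀ u, acc v u → Foc acc hwf u Γ (.inv none (.up A))) → Foc acc hwf w Γ (.inv none C)) :
    Foc acc hwf w Γ (.inv (some (.box A, v)) C) :=
  foc_iff_layer.2 (.boxL hv fun h => foc_iff_layer.1 (k fun u hu => (h u hu).2))

theorem Foc.upR {w : W} {Γ : List (Pos P N × W)} {A : Pos P N}
    (h : Foc acc hwf w Γ (.rfoc A)) : Foc acc hwf w Γ (.inv none (.up A)) :=
  foc_iff_layer.2 (.upR (foc_iff_layer.1 h))

theorem Foc.atomL {w : W} {Γ : List (Pos P N × W)} {Q : N} :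
    Foc acc hwf w Γ (.lfoc (.atom Q) w (.atom Q)) :=
  foc_iff_layer.2 .atomL

theorem Foc.upL {w v : W} {Γ : List (Pos P N × W)} {A : Pos P N} {C : Neg P N}
    (h : Foc acc hwf w Γ (.inv (some (A, v)) C)) : Foc acc hwf w Γ (.lfoc (.up A) v C) :=
  foc_iff_layer.2 (.upL (foc_iff_layer.1 h))

theorem Foc.impL {w v : W} {Γ : List (Pos P N × W)} {A : Pos P N} {B C : Neg P N}
    (hv : ReflTransGen acc w v) (h : Foc acc hwf v Γ (.rfoc A))
    (h' : Foc acc hwf w Γ (.lfoc B v C)) : Foc acc hwf w Γ (.lfoc (.imp A B) v C) :=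
  foc_iff_layer.2 (.impL (h.toLayer hv) (foc_iff_layer.1 h'))

/-- Induction on focused proofs with succedent at the fixed world `w`. -/
theorem Foc.induct {w : W} {motive : List (Pos P N × W) → Goal P N W → Prop}
    (atomR : ∀ {Γ Q}, (.atom Q, w) ∈ Γ → motive Γ (.rfoc (.atom Q)))
    (downR : ∀ {Γ A}, motive Γ (.inv none A) → motive Γ (.rfoc (.down A)))
    (diaR : ∀ {u Γ A}, acc w u → Foc acc hwf u Γ (.inv none (.up A)) → motive Γ (.rfoc (.dia A)))
    (boxR : ∀ {Γ A}, (∀ u, acc w u → Foc acc hwf u Γ (.inv none (.up A))) →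
      motive Γ (.rfoc (.box A)))
    (impR : ∀ {Γ A B}, motive Γ (.inv (some (A, w)) B) → motive Γ (.inv none (.imp A B)))
    (stableL : ∀ {v Γ A C}, A.Stable → motive ((A, v) :: Γ) (.inv none C) →
      motive Γ (.inv (some (A, v)) C))
    (downL : ∀ {v Γ A C}, (.down A, v) ∈ Γ → C.Stable → ReflTransGen acc w v →
      motive Γ (.lfoc A v C) → motive Γ (.inv none C))
    (botL : ∀ {v Γ C}, motive Γ (.inv (some (.bot, v)) C))
    (diaL : ∀ {v Γ A C}, ReflTransGen acc w v →
      (∀ u, acc v u → Foc acc hwf u Γ (.inv none (.up A)) → motive Γ (.inv none C)) →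
      motive Γ (.inv (some (.dia A, v)) C))
    (boxL : ∀ {v Γ A C}, ReflTransGen acc w v →
      ((∀ u, acc v u → Foc acc hwf u Γ (.inv none (.up A))) → motive Γ (.inv none C)) →
      motive Γ (.inv (some (.box A, v)) C))
    (upR : ∀ {Γ A}, Foc acc hwf w Γ (.rfoc A) → motive Γ (.rfoc A) → motive Γ (.inv none (.up A)))
    (atomL : ∀ {Γ Q}, motive Γ (.lfoc (.atom Q) w (.atom Q)))
    (upL : ∀ {v Γ A C}, motive Γ (.inv (some (A, v)) C) → motive Γ (.lfoc (.up A) v C))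
    (impL : ∀ {v Γ A B C}, ReflTransGen acc w v → Foc acc hwf v Γ (.rfoc A) →
      (v = w → motive Γ (.rfoc A)) → motive Γ (.lfoc B v C) → motive Γ (.lfoc (.imp A B) v C))
    {Γ : List (Pos P N × W)} {S : Goal P N W} (h : Foc acc hwf w Γ S) : motive Γ S := by
  suffices H : ∀ v Γ S,
      FocLayer acc (fun v Γ S => TransGen acc w v ∧ Foc acc hwf v Γ S) w v Γ S →
      ReflTransGen acc w v ∧ Foc acc hwf v Γ S ∧ (v = w → motive Γ S) from
    (H w Γ S (foc_iff_layer.1 h)).2.2 rfl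
  intro v Γ S h
  induction h with
  | earlier h =>
    refine ⟨h.1.to_reflTransGen, h.2, ?_⟩
    rintro rfl
    exact (not_transGen_self hwf _ h.1).elim
  | atomR h => exact ⟨.refl, .atomR h, fun _ => atomR h⟩
  | downR _ ih => exact ⟨.refl, .downR ih.2.1, fun _ => downR (ih.2.2 rfl)⟩
  | diaR hu _ ih => exact ⟨.refl, .diaR hu ih.2.1, fun _ => diaR hu ih.2.1⟩
  | boxR _ ih =>
    exact ⟨.refl, .boxR fun u hu => (ih u hu).2.1, fun _ => boxR fun u hu => (ih u hu).2.1⟩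
  | impR _ ih => exact ⟨.refl, .impR ih.2.1, fun _ => impR (ih.2.2 rfl)⟩
  | stableL hA _ ih => exact ⟨.refl, .stableL hA ih.2.1, fun _ => stableL hA (ih.2.2 rfl)⟩
  | downL hA hC hv _ ih =>
    exact ⟨.refl, .downL hA hC hv ih.2.1, fun _ => downL hA hC hv (ih.2.2 rfl)⟩
  | botL => exact ⟨.refl, .botL, fun _ => botL⟩
  | diaL hv _ ih =>
    exact ⟨.refl, .diaL hv fun u hu h => (ih u hu ⟨.tail' hv hu, h⟩).2.1,
      fun _ => diaL hv fun u hu h => (ih u hu ⟨.tail' hv hu, h⟩).2.2 rfl⟩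
  | boxL hv _ ih =>
    exact ⟨.refl, .boxL hv fun h => (ih fun u hu => ⟨.tail' hv hu, h u hu⟩).2.1,
      fun _ => boxL hv fun h => (ih fun u hu => ⟨.tail' hv hu, h u hu⟩).2.2 rfl⟩
  | upR _ ih => exact ⟨.refl, .upR ih.2.1, fun _ => upR ih.2.1 (ih.2.2 rfl)⟩
  | atomL => exact ⟨.refl, .atomL, fun _ => atomL⟩
  | upL _ ih => exact ⟨.refl, .upL ih.2.1, fun _ => upL (ih.2.2 rfl)⟩
  | impL _ _ ih ih' =>
    exact ⟨.refl, .impL ih.1 ih.2.1 ih'.2.1, fun _ => impL ih.1 ih.2.1 ih.2.2 (ih'.2.2 rfl)⟩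

/-- No rule ends in right focus on `⊥`, and `earlier` would place `w` above itself. -/
theorem Foc.bot_inv {w : W} {Γ : List (Pos P N × W)} (h : Foc acc hwf w Γ (.rfoc .bot)) :
    False := by
  cases foc_iff_layer.1 h with
  | earlier h => exact not_transGen_self hwf _ h.1

theorem Foc.dia_inv {w : W} {Γ : List (Pos P N × W)} {A : Pos P N}
    (h : Foc acc hwf w Γ (.rfoc (.dia A))) :
    ∃ u, acc w u ∧ Foc acc hwf u Γ (.inv none (.up A)) := by
  -- Inverting the layer directly would leave the premise inside the layer of `w`; the induction
  -- principle delivers it as provability at `u`.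
  refine Foc.induct (w := w) (motive := fun Γ S => S = .rfoc (.dia A) →
    ∃ u, acc w u ∧ Foc acc hwf u Γ (.inv none (.up A)))
    ?_ ?_ ?_ ?_ ?_ ?_ ?_ ?_ ?_ ?_ ?_ ?_ ?_ ?_ h rfl
  case refine_3 =>
    rintro u Γ A hu h ⟨⟩
    exact ⟨u, hu, h⟩
  all_goals
    intros
    simp_all

theorem Foc.box_inv {w : W} {Γ : List (Pos P N × W)} {A : Pos P N}
    (h : Foc acc hwf w Γ (.rfoc (.box A))) :
    ∀ u, acc w u → Foc acc hwf u Γ (.inv none (.up A)) := by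
  refine Foc.induct (w := w) (motive := fun Γ S => S = .rfoc (.box A) →
    ∀ u, acc w u → Foc acc hwf u Γ (.inv none (.up A)))
    ?_ ?_ ?_ ?_ ?_ ?_ ?_ ?_ ?_ ?_ ?_ ?_ ?_ ?_ h rfl
  case refine_4 =>
    rintro Γ A h ⟨⟩
    exact h
  all_goals
    intros
    simp_all

-- Erasure of polarities and the statement proved by induction on worlds.

mutual
/-- The unpolarized proposition underlying a positive proposition. -/
def Pos.erase : Pos P N → Form P N
  | .atom Q => .posAtom Q
  | .down A => A.erase
  | .bot => .bot
  | .dia A => .dia A.erase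
  | .box A => .box A.erase
/-- The unpolarized proposition underlying a negative proposition. -/
def Neg.erase : Neg P N → Form P N
  | .atom Q => .negAtom Q
  | .up A => A.erase
  | .imp A B => .imp A.erase B.erase
end

theorem Form.erase_polarize (A : Form P N) : A.toPos.erase = A ∧ A.toNeg.erase = A := by
  induction A with
  | posAtom | negAtom | bot => simp [Form.toPos, Form.toNeg, Pos.erase, Neg.erase]
  | imp A B ihA ihB => simp [Form.toPos, Form.toNeg, Pos.erase, Neg.erase, ihA.1, ihB.2]
  | dia A ih | box A ih => simp [Form.toPos, Form.toNeg, Pos.erase, Neg.erase, ih.1]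

theorem Form.erase_toHyp (A : Form P N) : A.toHyp.erase = A := by
  cases A <;> simp [Form.toHyp, Pos.erase, Neg.erase, Form.erase_polarize]

theorem Form.toHyp_stable (A : Form P N) : A.toHyp.Stable := by
  cases A <;> constructor

/-- The unpolarized context underlying a polarized one. -/
def eraseCtx (Γ : List (Pos P N × W)) : List (Form P N × W) :=
  Γ.map fun h => (h.1.erase, h.2)

theorem mem_eraseCtx {A : Pos P N} {v : W} {Γ : List (Pos P N × W)} (h : (A, v) ∈ Γ) :
    (A.erase, v) ∈ eraseCtx Γ :=
  List.mem_map.2 ⟨_, h, rfl⟩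

theorem eraseCtx_polCtx (Γ : List (Form P N × W)) : eraseCtx (polCtx Γ) = Γ := by
  simp [eraseCtx, polCtx, Function.comp_def, Form.erase_toHyp]

/-- All hypotheses are stable. -/
def StableCtx (Γ : List (Pos P N × W)) : Prop :=
  ∀ A v, (A, v) ∈ Γ → A.Stable

theorem StableCtx.cons {Γ : List (Pos P N × W)} (h : StableCtx Γ) {A : Pos P N} (hA : A.Stable)
    (v : W) : StableCtx ((A, v) :: Γ) := by
  intro B u hB
  rcases List.mem_cons.1 hB with hB | hB
  · cases hB
    exact hA
  · exact h B u hB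

theorem stableCtx_polCtx (Γ : List (Form P N × W)) : StableCtx (polCtx Γ) := by
  intro A v h
  obtain ⟨B, -, hB⟩ := List.mem_map.1 h
  cases hB
  exact B.1.toHyp_stable

/-- At the world `w`, focused proofs from stable contexts prove the same as natural deduction. -/
def FocusingAt (P : Type p) (N : Type n) (acc : W → W → Prop)
    (hwf : WellFounded fun u v => acc v u) (w : W) : Prop :=
  ∀ Γ : List (Pos P N × W), StableCtx Γ → ∀ C : Neg P N,
    Foc acc hwf w Γ (.inv none C) ↔ ND acc hwf w (eraseCtx Γ) C.erase

theorem FocusingAt.up_iff {w : W} (h : FocusingAt P N acc hwf w) {Γ : List (Pos P N × W)}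
    (hΓ : StableCtx Γ) {A : Pos P N} :
    Foc acc hwf w Γ (.inv none (.up A)) ↔ ND acc hwf w (eraseCtx Γ) A.erase := by
  rw [h Γ hΓ, Neg.erase]

theorem FocusingAt.nd_of_rfoc {w : W} (h : FocusingAt P N acc hwf w) {Γ : List (Pos P N × W)}
    (hΓ : StableCtx Γ) {A : Pos P N} (hA : Foc acc hwf w Γ (.rfoc A)) :
    ND acc hwf w (eraseCtx Γ) A.erase :=
  (h.up_iff hΓ).1 hA.upR

/-! ### Soundness -/

/-- The natural deduction reading of a focused sequent with succedent at `w`, in the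
context `Δ`. -/
def Goal.Sound (acc : W → W → Prop) (hwf : WellFounded fun u v => acc v u) (w : W)
    (Δ : List (Form P N × W)) : Goal P N W → Prop
  | .rfoc A => ND acc hwf w Δ A.erase
  | .inv none C => ND acc hwf w Δ C.erase
  | .inv (some (A, v)) C =>
    ReflTransGen acc w v → ND acc hwf v Δ A.erase → ND acc hwf w Δ C.erase
  | .lfoc A v C => ReflTransGen acc w v → ND acc hwf v Δ A.erase → ND acc hwf w Δ C.erase

/-- Separating `Δ` from the erased context builds the needed substitutions into the induction:
hypotheses stored by the focused proof need only be provable from `Δ`. -/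
theorem Foc.sound_of_above {w : W} (above : ∀ u, TransGen acc w u → FocusingAt P N acc hwf u)
    {Γ : List (Pos P N × W)} {S : Goal P N W} (h : Foc acc hwf w Γ S) (hΓ : StableCtx Γ)
    {Δ : List (Form P N × W)} (agree : AgreeAbove acc hwf w (eraseCtx Γ) Δ)
    (hyps : ∀ A, (A, w) ∈ eraseCtx Γ → ND acc hwf w Δ A) : S.Sound acc hwf w Δ := by
  have up : ∀ {Γ : List (Pos P N × W)} {Δ u A}, StableCtx Γ →
      AgreeAbove acc hwf w (eraseCtx Γ) Δ → TransGen acc w u →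
      (Foc acc hwf u Γ (.inv none (.up A)) ↔ ND acc hwf u Δ A.erase) :=
    fun hΓ agree hu => ((above _ hu).up_iff hΓ).trans (agree _ hu _)
  refine Foc.induct (w := w) (motive := fun Γ S => StableCtx Γ → ∀ Δ,
    AgreeAbove acc hwf w (eraseCtx Γ) Δ →
    (∀ A, (A, w) ∈ eraseCtx Γ → ND acc hwf w Δ A) → S.Sound acc hwf w Δ)
    ?_ ?_ ?_ ?_ ?_ ?_ ?_ ?_ ?_ ?_ ?_ ?_ ?_ ?_ h hΓ Δ agree hyps
  · exact fun h _ Δ _ hyps => hyps _ (mem_eraseCtx h)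
  · intro Γ A ih hΓ Δ agree hyps
    have := ih hΓ Δ agree hyps
    simpa only [Goal.Sound, Pos.erase] using this
  · intro u Γ A hu h hΓ Δ agree hyps
    simp only [Goal.Sound, Pos.erase]
    exact .diaI hu ((up hΓ agree (.single hu)).1 h)
  · intro Γ A h hΓ Δ agree hyps
    simp only [Goal.Sound, Pos.erase]
    exact .boxI fun u hu => (up hΓ agree (.single hu)).1 (h u hu)
  · intro Γ A B ih hΓ Δ agree hyps
    simp only [Goal.Sound, Neg.erase]
    -- Only `Δ` grows here, since `A` is still in the inversion position; being at `w`, it changes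
    -- nothing above.
    exact .impI (ih hΓ ((A.erase, w) :: Δ) (agree.trans (AgreeAbove.cons_self w _ Δ).symm)
      (fun B hB => (hyps B hB).weaken_cons) .refl (.hyp List.mem_cons_self))
  · intro v Γ A C hA ih hΓ Δ agree hyps hv hAv
    -- Now only `Γ` grows. Agreement above survives because the stored judgment is either at `w` or
    -- at a higher world where it is already provable.
    refine ih (hΓ.cons hA v) Δ ?_ fun B hB => ?_
    · rcases reflTransGen_iff_eq_or_transGen.1 hv with rfl | hv
      · exact (AgreeAbove.cons_self _ _ _).trans agree
      · exact fun u hu B => (((agree v hv _).2 hAv).cons_iff u B).trans (agree u hu B)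
    · rcases List.mem_cons.1 hB with hB | hB
      · cases hB
        exact hAv
      · exact hyps B hB
  · intro v Γ A C hA _ hv ih hΓ Δ agree hyps
    have hA' : (A.erase, v) ∈ eraseCtx Γ := by simpa only [Pos.erase] using mem_eraseCtx hA
    refine ih hΓ Δ agree hyps hv ?_
    rcases reflTransGen_iff_eq_or_transGen.1 hv with rfl | hv
    · exact hyps _ hA'
    · exact (agree v hv _).1 (.hyp hA')
  · intro v Γ C _ Δ _ _ hv h
    simp only [Pos.erase] at h
    exact .botE hv h
  · intro v Γ A C hv ih hΓ Δ agree hyps _ h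
    simp only [Pos.erase] at h
    exact .diaE hv h fun u hu h' =>
      ih u hu ((up hΓ agree (.tail' hv hu)).2 h') hΓ Δ agree hyps
  · intro v Γ A C hv ih hΓ Δ agree hyps _ h
    simp only [Pos.erase] at h
    exact .boxE hv h fun h' =>
      ih (fun u hu => (up hΓ agree (.tail' hv hu)).2 (h' u hu)) hΓ Δ agree hyps
  · intro Γ A _ ih hΓ Δ agree hyps
    have := ih hΓ Δ agree hyps
    simpa only [Goal.Sound, Neg.erase] using this
  · exact fun _ _ _ _ _ h => h
  · intro v Γ A C ih hΓ Δ agree hyps hv h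
    simp only [Neg.erase] at h
    exact ih hΓ Δ agree hyps hv h
  · intro v Γ A B C hv hA ihA ih hΓ Δ agree hyps _ h
    simp only [Neg.erase] at h
    refine ih hΓ Δ agree hyps hv (.impE h ?_)
    rcases reflTransGen_iff_eq_or_transGen.1 hv with rfl | hv
    · exact ihA rfl hΓ Δ agree hyps
    · exact (agree v hv _).1 ((above v hv).nd_of_rfoc hΓ hA)

/-! ### Weakening and transport of focused proofs -/

/-- `Γ'` is a stable extension of `Γ` that leaves provability above `w` unchanged. -/
structure Extends (acc : W → W → Prop) (hwf : WellFounded fun u v => acc v u) (w : W)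
    (Γ Γ' : List (Pos P N × W)) : Prop where
  sub : ∀ h, h ∈ Γ → h ∈ Γ'
  stable : StableCtx Γ'
  agree : AgreeAbove acc hwf w (eraseCtx Γ) (eraseCtx Γ')

theorem Extends.refl {Γ : List (Pos P N × W)} (hΓ : StableCtx Γ) (w : W) :
    Extends acc hwf w Γ Γ :=
  ⟨fun _ h => h, hΓ, .refl _ _⟩

theorem Extends.trans {w : W} {Γ Γ' Γ'' : List (Pos P N × W)} (h : Extends acc hwf w Γ Γ')
    (h' : Extends acc hwf w Γ' Γ'') : Extends acc hwf w Γ Γ'' :=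
  ⟨fun x hx => h'.sub x (h.sub x hx), h'.stable, h.agree.trans h'.agree⟩

theorem Extends.cons_self {w : W} {Γ : List (Pos P N × W)} (hΓ : StableCtx Γ) {A : Pos P N}
    (hA : A.Stable) : Extends acc hwf w Γ ((A, w) :: Γ) :=
  ⟨fun _ h => List.mem_cons_of_mem _ h, hΓ.cons hA w, (AgreeAbove.cons_self w _ _).symm⟩

theorem Extends.cons_provable {w v : W} {Γ : List (Pos P N × W)} (hΓ : StableCtx Γ) {A : Pos P N}
    (hA : A.Stable) (h : ND acc hwf v (eraseCtx Γ) A.erase) :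
    Extends acc hwf w Γ ((A, v) :: Γ) :=
  ⟨fun _ h => List.mem_cons_of_mem _ h, hΓ.cons hA v, fun u _ B => (h.cons_iff u B).symm⟩

theorem Extends.cons_cons {w v : W} {Γ Γ' : List (Pos P N × W)} (h : Extends acc hwf w Γ Γ')
    {A : Pos P N} (hA : A.Stable) (hv : v = w ∨ TransGen acc w v ∧
      ND acc hwf v (eraseCtx Γ) A.erase) :
    Extends acc hwf w ((A, v) :: Γ) ((A, v) :: Γ') := by
  refine ⟨fun B hB => ?_, h.stable.cons hA v, ?_⟩
  · rcases List.mem_cons.1 hB with hB | hB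
    · exact List.mem_cons.2 (.inl hB)
    · exact List.mem_cons.2 (.inr (h.sub B hB))
  · rcases hv with rfl | ⟨hv, hA⟩
    · exact h.agree.cons_cons _
    · exact fun u hu B => ((hA.cons_iff u B).trans (h.agree u hu B)).trans
        (((h.agree v hv _).1 hA).cons_iff u B).symm

theorem Extends.above {w u : W} {Γ Γ' : List (Pos P N × W)} (h : Extends acc hwf w Γ Γ')
    (hu : TransGen acc w u) : Extends acc hwf u Γ Γ' :=
  ⟨h.sub, h.stable, fun v hv => h.agree v (hu.trans hv)⟩

/-- A distinguished left judgment at a world above `w` is provable; at `w` itself nothing is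
required. -/
def Goal.LeftProvable (acc : W → W → Prop) (hwf : WellFounded fun u v => acc v u) (w : W)
    (Γ : List (Pos P N × W)) : Goal P N W → Prop
  | .rfoc _ => True
  | .inv none _ => True
  | .inv (some (A, v)) _ => v = w ∨ TransGen acc w v ∧ ND acc hwf v (eraseCtx Γ) A.erase
  | .lfoc A v _ => v = w ∨ TransGen acc w v ∧ ND acc hwf v (eraseCtx Γ) A.erase

/-- A left judgment may eventually be stored in both contexts. `LeftProvable` guarantees that this
preserves agreement above `w`, and left focus maintains it down to that point. -/
theorem Foc.weaken {w : W} (above : ∀ u, TransGen acc w u → FocusingAt P N acc hwf u)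
    {Γ Γ' : List (Pos P N × W)} {S : Goal P N W} (h : Foc acc hwf w Γ S) (hΓ : StableCtx Γ)
    (hS : S.LeftProvable acc hwf w Γ) (ext : Extends acc hwf w Γ Γ') : Foc acc hwf w Γ' S := by
  induction w using (wf_transGen hwf).induction generalizing Γ Γ' S with
  | _ w IH =>
  have up : ∀ {Γ Γ' : List (Pos P N × W)} {u A}, StableCtx Γ → Extends acc hwf w Γ Γ' →
      TransGen acc w u →
      (Foc acc hwf u Γ (.inv none (.up A)) ↔ Foc acc hwf u Γ' (.inv none (.up A))) :=
    fun hΓ ext hu => (((above _ hu).up_iff hΓ).trans (ext.agree _ hu _)).trans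
      ((above _ hu).up_iff ext.stable).symm
  refine Foc.induct (w := w) (motive := fun Γ S => StableCtx Γ → S.LeftProvable acc hwf w Γ →
    ∀ Γ', Extends acc hwf w Γ Γ' → Foc acc hwf w Γ' S)
    ?_ ?_ ?_ ?_ ?_ ?_ ?_ ?_ ?_ ?_ ?_ ?_ ?_ ?_ h hΓ hS Γ' ext
  · exact fun h _ _ Γ' ext => .atomR (ext.sub _ h)
  · exact fun ih hΓ _ Γ' ext => .downR (ih hΓ trivial Γ' ext)
  · exact fun hu h hΓ _ Γ' ext => .diaR hu ((up hΓ ext (.single hu)).1 h)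
  · exact fun h hΓ _ Γ' ext => .boxR fun u hu => (up hΓ ext (.single hu)).1 (h u hu)
  · exact fun ih hΓ _ Γ' ext => .impR (ih hΓ (.inl rfl) Γ' ext)
  · exact fun hA ih hΓ hv Γ' ext => .stableL hA (ih (hΓ.cons hA _) trivial _ (ext.cons_cons hA hv))
  · intro v Γ A C hA hC hv ih hΓ _ Γ' ext
    refine .downL (ext.sub _ hA) hC hv (ih hΓ ?_ Γ' ext)
    refine (reflTransGen_iff_eq_or_transGen.1 hv).imp id fun hv => ⟨hv, .hyp ?_⟩
    simpa only [Pos.erase] using mem_eraseCtx hA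
  · exact fun _ _ Γ' _ => .botL
  · exact fun hv ih hΓ _ Γ' ext => .diaL hv fun u hu h =>
      ih u hu ((up hΓ ext (.tail' hv hu)).2 h) hΓ trivial Γ' ext
  · exact fun hv ih hΓ _ Γ' ext => .boxL hv fun h =>
      ih (fun u hu => (up hΓ ext (.tail' hv hu)).2 (h u hu)) hΓ trivial Γ' ext
  · exact fun _ ih hΓ _ Γ' ext => .upR (ih hΓ trivial Γ' ext)
  · exact fun _ _ Γ' _ => .atomL
  · intro v Γ A C ih hΓ hv Γ' ext
    simp only [Goal.LeftProvable, Neg.erase] at hv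
    exact .upL (ih hΓ hv Γ' ext)
  · intro v Γ A B C hv hA ihA ih hΓ hv' Γ' ext
    simp only [Goal.LeftProvable, Neg.erase] at hv'
    rcases hv' with rfl | ⟨hv', h⟩
    · exact .impL hv (ihA rfl hΓ trivial Γ' ext) (ih hΓ (.inl rfl) Γ' ext)
    · exact .impL hv
        -- The argument of the implication is proved at the higher world `v`, so it is weakened by
        -- the induction on worlds. Its natural deduction counterpart then keeps the remaining focus
        -- provable.
        (IH v hv' (fun u hu => above u (hv'.trans hu)) hA hΓ trivial (ext.above hv'))
        (ih hΓ (.inr ⟨hv', h.impE ((above v hv').nd_of_rfoc hΓ hA)⟩) Γ' ext)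

/-- The statement that `S`, with its succedent `↑X[v]` replaced by `C[w]`, is provable. -/
def Goal.Transported (acc : W → W → Prop) (hwf : WellFounded fun u v => acc v u) (v w : W)
    (X : Pos P N) (C : Neg P N) (Γ : List (Pos P N × W)) : Goal P N W → Prop
  | .rfoc _ => True
  | .inv none D => D = .up X → Foc acc hwf w Γ (.inv none C)
  | .inv (some (A, u)) D => D = .up X → ReflTransGen acc v u →
      ND acc hwf u (eraseCtx Γ) A.erase → Foc acc hwf w Γ (.inv (some (A, u)) C)
  | .lfoc A u D => D = .up X → ReflTransGen acc v u →
      ND acc hwf u (eraseCtx Γ) A.erase → Foc acc hwf w Γ (.lfoc A u C)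

/-- A focused proof of `↑X` at a world `v` above `w` can be used for a stable succedent at `w`. -/
theorem Foc.transport {w v : W} (above : ∀ u, TransGen acc w u → FocusingAt P N acc hwf u)
    (hwv : TransGen acc w v) {Γ : List (Pos P N × W)} (hΓ : StableCtx Γ) {X : Pos P N}
    (h : Foc acc hwf v Γ (.inv none (.up X))) {C : Neg P N} (hC : C.Stable)
    (k : ∀ Γ', Extends acc hwf w Γ Γ' → Foc acc hwf v Γ' (.rfoc X) →
      Foc acc hwf w Γ' (.inv none C)) :
    Foc acc hwf w Γ (.inv none C) := by
  refine Foc.induct (w := v) (motive := fun Γ S => StableCtx Γ →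
    (∀ Γ', Extends acc hwf w Γ Γ' → Foc acc hwf v Γ' (.rfoc X) → Foc acc hwf w Γ' (.inv none C)) →
    S.Transported acc hwf v w X C Γ)
    ?_ ?_ ?_ ?_ ?_ ?_ ?_ ?_ ?_ ?_ ?_ ?_ ?_ ?_ h hΓ k rfl
  · exact fun _ _ _ => trivial
  · exact fun _ _ _ => trivial
  · exact fun _ _ _ _ => trivial
  · exact fun _ _ _ => trivial
  · intro Γ A B _ _ _ h
    cases h
  · intro u Γ A D hA ih hΓ k hD hu h
    -- The stored judgment is provable at `u`, so the enlarged context is still an extension over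
    -- `w` and the continuation remains applicable.
    exact .stableL hA (ih (hΓ.cons hA u)
      (fun Γ' ext => k Γ' ((Extends.cons_provable hΓ hA h).trans ext)) hD)
  · intro u Γ A D hA _ hu ih hΓ k hD
    refine .downL hA hC (hwv.to_reflTransGen.trans hu) (ih hΓ k hD hu (.hyp ?_))
    simpa only [Pos.erase] using mem_eraseCtx hA
  · exact fun _ _ _ _ _ => .botL
  · exact fun hu ih hΓ k hD _ _ => .diaL (hwv.to_reflTransGen.trans hu)
      fun u' hu' h => ih u' hu' h hΓ k hD
  · exact fun hu ih hΓ k hD _ _ => .boxL (hwv.to_reflTransGen.trans hu)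
      fun h => ih h hΓ k hD
  · intro Γ A h _ hΓ k hD
    cases hD
    exact k Γ (.refl hΓ w) h
  · intro Γ Q _ _ h
    cases h
  · intro u Γ A D ih hΓ k hD hu h
    simp only [Neg.erase] at h
    exact .upL (ih hΓ k hD hu h)
  · intro u Γ A B D hu hA _ ih hΓ k hD _ h
    simp only [Neg.erase] at h
    exact .impL (hwv.to_reflTransGen.trans hu) hA (ih hΓ k hD hu
      (h.impE ((above u (hwv.trans_left hu)).nd_of_rfoc hΓ hA)))

/-! ### Completeness, by a Kripke model built from focused proofs -/

/-- Continuations into focused proofs at `w` with stable succedent. -/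
def Cover (acc : W → W → Prop) (hwf : WellFounded fun u v => acc v u) (w : W)
    (X : List (Pos P N × W) → Prop) (Γ : List (Pos P N × W)) : Prop :=
  ∀ C : Neg P N, C.Stable → ∀ Γ', Extends acc hwf w Γ Γ' →
    (∀ Γ'', Extends acc hwf w Γ' Γ'' → X Γ'' → Foc acc hwf w Γ'' (.inv none C)) →
    Foc acc hwf w Γ' (.inv none C)

/-- Truth of a proposition at `w` in the model whose states are the stable contexts. -/
def Forces (acc : W → W → Prop) (hwf : WellFounded fun u v => acc v u) (w : W) :
    Form P N → List (Pos P N × W) → Prop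
  | .posAtom Q, Γ => Cover acc hwf w (fun Γ => (.atom Q, w) ∈ Γ) Γ
  | .negAtom Q, Γ => Foc acc hwf w Γ (.inv none (.atom Q))
  | .bot, Γ => Cover acc hwf w (fun _ => False) Γ
  | .imp A B, Γ => ∀ Γ', Extends acc hwf w Γ Γ' → Forces acc hwf w A Γ' → Forces acc hwf w B Γ'
  | .dia A, Γ => Cover acc hwf w (fun Γ => ∃ u, acc w u ∧ ND acc hwf u (eraseCtx Γ) A) Γ
  | .box A, Γ => Cover acc hwf w (fun Γ => ∀ u, acc w u → ND acc hwf u (eraseCtx Γ) A) Γ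

theorem Cover.mono {w : W} {X : List (Pos P N × W) → Prop} {Γ Γ' : List (Pos P N × W)}
    (h : Cover acc hwf w X Γ) (ext : Extends acc hwf w Γ Γ') : Cover acc hwf w X Γ' :=
  fun C hC Γ'' ext' k => h C hC Γ'' (ext.trans ext') k

theorem Cover.bind {w : W} {X Y : List (Pos P N × W) → Prop} {Γ : List (Pos P N × W)}
    (h : Cover acc hwf w X Γ)
    (f : ∀ Γ', Extends acc hwf w Γ Γ' → X Γ' → Cover acc hwf w Y Γ') : Cover acc hwf w Y Γ :=
  fun C hC Γ' ext k => h C hC Γ' ext fun Γ'' ext' hX =>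
    f Γ'' (ext.trans ext') hX C hC Γ'' (.refl ext'.stable w)
      fun Γ''' ext'' hY => k Γ''' (ext'.trans ext'') hY

theorem Cover.pure {w : W} {X : List (Pos P N × W) → Prop} {Γ : List (Pos P N × W)}
    (h : ∀ Γ', Extends acc hwf w Γ Γ' → X Γ') : Cover acc hwf w X Γ :=
  fun _ _ Γ' ext k => k Γ' (.refl ext.stable w) (h Γ' ext)

theorem Forces.mono {w : W} (above : ∀ u, TransGen acc w u → FocusingAt P N acc hwf u)
    {A : Form P N} {Γ Γ' : List (Pos P N × W)} (hΓ : StableCtx Γ) (h : Forces acc hwf w A Γ)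
    (ext : Extends acc hwf w Γ Γ') : Forces acc hwf w A Γ' := by
  cases A with
  | posAtom | bot | dia | box =>
    simp only [Forces] at h ⊢
    exact h.mono ext
  | negAtom =>
    simp only [Forces] at h ⊢
    exact h.weaken above hΓ trivial ext
  | imp A B =>
    simp only [Forces] at h ⊢
    exact fun Γ'' ext' => h Γ'' (ext.trans ext')

/-- Positive connectives and modalities are covers already; a negative atom is itself a stable
succedent, so the cover can be run on it; implication inherits the property from its conclusion.
This is what permits eliminations into arbitrary propositions. -/
theorem Forces.of_cover {w : W} (above : ∀ u, TransGen acc w u → FocusingAt P N acc hwf u)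
    {A : Form P N} {Γ : List (Pos P N × W)} (hΓ : StableCtx Γ)
    (h : Cover acc hwf w (Forces acc hwf w A) Γ) : Forces acc hwf w A Γ := by
  induction A generalizing Γ with
  | posAtom | bot | dia | box =>
    simp only [Forces] at h ⊢
    exact h.bind fun Γ' _ h' => h'
  | negAtom Q =>
    simp only [Forces] at h ⊢
    exact h _ (.atom Q) Γ (.refl hΓ w) fun _ _ h' => h'
  | imp A B _ ihB =>
    simp only [Forces] at h ⊢
    intro Γ' ext hA
    refine ihB ext.stable ((h.mono ext).bind fun Γ'' ext' hAB => .pure fun Γ''' ext'' => ?_)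
    exact hAB Γ''' ext'' (hA.mono above ext.stable (ext'.trans ext''))

/-- Soundness of natural deduction in the model. -/
theorem ND.forces {w : W} (above : ∀ u, TransGen acc w u → FocusingAt P N acc hwf u)
    {Θ : List (Form P N × W)} {A : Form P N} (h : ND acc hwf w Θ A)
    {Γ : List (Pos P N × W)} (hΓ : StableCtx Γ) (agree : AgreeAbove acc hwf w Θ (eraseCtx Γ))
    (env : ∀ B, (B, w) ∈ Θ → Forces acc hwf w B Γ) : Forces acc hwf w A Γ := by
  -- For a major premise strictly above `w`: `FocusingAt` at `v` supplies a focused proof, and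
  -- transporting it to `w` reduces the problem to a right focus on `X` at `v`, whose last rule can
  -- be inverted.
  have lift : ∀ {v : W} {X : Pos P N} {Θ Γ} {Y : List (Pos P N × W) → Prop}, TransGen acc w v →
      StableCtx Γ → AgreeAbove acc hwf w Θ (eraseCtx Γ) → ND acc hwf v Θ X.erase →
      (∀ Γ', Extends acc hwf w Γ Γ' → Foc acc hwf v Γ' (.rfoc X) → Y Γ') →
      Cover acc hwf w Y Γ := by
    intro v X Θ Γ Y hv hΓ agree h f C hC Γ' ext k
    have h' := ((above v hv).up_iff ext.stable).2
      ((ext.agree v hv _).1 ((agree v hv _).1 h))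
    exact h'.transport above hv ext.stable hC fun Γ'' ext' hX =>
      k Γ'' ext' (f Γ'' (ext.trans ext') hX)
  refine ND.induct (w := w) (motive := fun Θ A => ∀ Γ, StableCtx Γ →
    AgreeAbove acc hwf w Θ (eraseCtx Γ) → (∀ B, (B, w) ∈ Θ → Forces acc hwf w B Γ) →
    Forces acc hwf w A Γ) ?_ ?_ ?_ ?_ ?_ ?_ ?_ ?_ h Γ hΓ agree env
  · exact fun h Γ _ _ env => env _ h
  · intro v Θ C hv h ih Γ hΓ agree env
    have key : Cover acc hwf w (fun _ => False) Γ := by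
      rcases reflTransGen_iff_eq_or_transGen.1 hv with rfl | hv
      · simpa only [Forces] using ih rfl Γ hΓ agree env
      · refine lift (X := .bot) hv hΓ agree (by simpa only [Pos.erase] using h)
          fun Γ' ext h' => ?_
        exact h'.bot_inv
    exact .of_cover above hΓ (key.bind fun _ _ h => h.elim)
  · intro Θ A B ih Γ hΓ agree env
    simp only [Forces]
    intro Γ' ext hA
    refine ih Γ' ext.stable (((AgreeAbove.cons_self w A Θ).trans agree).trans ext.agree)
      fun C hC => ?_
    rcases List.mem_cons.1 hC with hC | hC
    · cases hC
      exact hA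
    · exact (env C hC).mono above hΓ ext
  · intro Θ A B ih ihA Γ hΓ agree env
    have h := ih Γ hΓ agree env
    simp only [Forces] at h
    exact h Γ (.refl hΓ w) (ihA Γ hΓ agree env)
  · intro u Θ A hu h Γ hΓ agree env
    simp only [Forces]
    exact .pure fun Γ' ext => ⟨u, hu, (ext.agree u (.single hu) _).1 ((agree u (.single hu) _).1 h)⟩
  · intro Θ A h Γ hΓ agree env
    simp only [Forces]
    exact .pure fun Γ' ext u hu =>
      (ext.agree u (.single hu) _).1 ((agree u (.single hu) _).1 (h u hu))
  · intro v Θ A C hv h ih k Γ hΓ agree env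
    have key : Cover acc hwf w (fun Γ => ∃ u, acc v u ∧ ND acc hwf u (eraseCtx Γ) A) Γ := by
      rcases reflTransGen_iff_eq_or_transGen.1 hv with rfl | hv
      · simpa only [Forces] using ih rfl Γ hΓ agree env
      · refine lift (X := .dia A.toPos) hv hΓ agree
          (by simpa only [Pos.erase, A.erase_polarize.1] using h) fun Γ' ext h' => ?_
        obtain ⟨u, hu, h'⟩ := h'.dia_inv
        refine ⟨u, hu, ?_⟩
        simpa only [A.erase_polarize.1] using
          ((above u (.tail hv hu)).up_iff ext.stable).1 h'
    -- Under the cover there is a concrete `u` at which the current context proves `A`. Agreement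
    -- carries this back to `Θ`, where the continuation of `diaE` accepts it.
    refine .of_cover above hΓ (key.bind fun Γ' ext ⟨u, hu, h'⟩ => .pure fun Γ'' ext' => ?_)
    have agree' := (agree.trans ext.agree)
    exact k u hu ((agree' u (.tail' hv hu) _).2 h') Γ'' ext'.stable (agree'.trans ext'.agree)
      fun B hB => (env B hB).mono above hΓ (ext.trans ext')
  · intro v Θ A C hv h ih k Γ hΓ agree env
    have key : Cover acc hwf w (fun Γ => ∀ u, acc v u → ND acc hwf u (eraseCtx Γ) A) Γ := by
      rcases reflTransGen_iff_eq_or_transGen.1 hv with rfl | hv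
      · simpa only [Forces] using ih rfl Γ hΓ agree env
      · refine lift (X := .box A.toPos) hv hΓ agree
          (by simpa only [Pos.erase, A.erase_polarize.1] using h) fun Γ' ext h' => ?_
        intro u hu
        simpa only [A.erase_polarize.1] using
          ((above u (.tail hv hu)).up_iff ext.stable).1 (h'.box_inv u hu)
    refine .of_cover above hΓ (key.bind fun Γ' ext h' => .pure fun Γ'' ext' => ?_)
    have agree' := (agree.trans ext.agree)
    exact k (fun u hu => (agree' u (.tail' hv hu) _).2 (h' u hu)) Γ'' ext'.stable
      (agree'.trans ext'.agree) fun B hB => (env B hB).mono above hΓ (ext.trans ext')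

-- Reification and reflection.

/-- Left focus on `A` at `w` is available for stable succedents at `w`. -/
def Neutral (acc : W → W → Prop) (hwf : WellFounded fun u v => acc v u) (w : W) (A : Neg P N)
    (Γ : List (Pos P N × W)) : Prop :=
  ∀ Γ', Extends acc hwf w Γ Γ' → ∀ C : Neg P N, C.Stable →
    Foc acc hwf w Γ' (.lfoc A w C) → Foc acc hwf w Γ' (.inv none C)

theorem Neutral.of_mem {w : W} {A : Neg P N} {Γ : List (Pos P N × W)} (h : (.down A, w) ∈ Γ) :
    Neutral acc hwf w A Γ :=
  fun _ ext _ hC h' => .downL (ext.sub _ h) hC .refl h'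

-- The two halves of normalization by evaluation, by recursion on the polarized proposition.
-- Reification reads a focused proof off forcing; reflection makes a proposition in left inversion
-- or left focus count as forced. The positive reflection allows any negative `C`, since after
-- `impR` the succedent may be another implication.
mutual
theorem Pos.reify_reflect {w : W} (above : ∀ u, TransGen acc w u → FocusingAt P N acc hwf u) :
    ∀ A : Pos P N, (∀ Γ, StableCtx Γ → Forces acc hwf w A.erase Γ →
        Cover acc hwf w (fun Γ => Foc acc hwf w Γ (.rfoc A)) Γ) ∧
      (∀ Γ, StableCtx Γ → ∀ C : Neg P N,
        (∀ Γ', Extends acc hwf w Γ Γ' → Forces acc hwf w A.erase Γ' →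
          Foc acc hwf w Γ' (.inv none C)) →
        Foc acc hwf w Γ (.inv (some (A, w)) C))
  | .atom Q => by
    simp only [Pos.erase, Forces]
    refine ⟨fun Γ hΓ h => h.bind fun Γ' ext hQ => .pure fun Γ'' ext' => .atomR (ext'.sub _ hQ),
      fun Γ hΓ C k => .stableL (.atom Q) (k _ (.cons_self hΓ (.atom Q)) (.pure ?_))⟩
    exact fun Γ' ext => ext.sub _ List.mem_cons_self
  | .down A => by
    have ih := Neg.reify_reflect above A
    simp only [Pos.erase]
    refine ⟨fun Γ hΓ h => .pure fun Γ' ext =>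
        .downR (ih.1 Γ' ext.stable (h.mono above hΓ ext)),
      fun Γ hΓ C k => .stableL (.down A) (k _ (.cons_self hΓ (.down A)) ?_)⟩
    exact ih.2 _ (hΓ.cons (.down A) w) (.of_mem List.mem_cons_self)
  | .bot => by
    simp only [Pos.erase, Forces]
    exact ⟨fun Γ hΓ h => h.bind fun _ _ h => h.elim, fun Γ hΓ C k => .botL⟩
  | .dia A => by
    simp only [Pos.erase, Forces]
    refine ⟨fun Γ hΓ h => h.bind fun Γ' ext ⟨u, hu, h'⟩ => .pure fun Γ'' ext' => ?_,
      fun Γ hΓ C k => .diaL .refl fun u hu h' => k Γ (.refl hΓ w) (.pure fun Γ' ext => ?_)⟩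
    · exact .diaR hu (((above u (.single hu)).up_iff ext'.stable).2
        ((ext'.agree u (.single hu) _).1 h'))
    · exact ⟨u, hu, (ext.agree u (.single hu) _).1 (((above u (.single hu)).up_iff hΓ).1 h')⟩
  | .box A => by
    simp only [Pos.erase, Forces]
    refine ⟨fun Γ hΓ h => h.bind fun Γ' ext h' => .pure fun Γ'' ext' => .boxR fun u hu => ?_,
      fun Γ hΓ C k => .boxL .refl fun h' => k Γ (.refl hΓ w) (.pure fun Γ' ext u hu => ?_)⟩
    · exact ((above u (.single hu)).up_iff ext'.stable).2 ((ext'.agree u (.single hu) _).1 (h' u hu))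
    · exact (ext.agree u (.single hu) _).1 (((above u (.single hu)).up_iff hΓ).1 (h' u hu))
theorem Neg.reify_reflect {w : W} (above : ∀ u, TransGen acc w u → FocusingAt P N acc hwf u) :
    ∀ A : Neg P N, (∀ Γ, StableCtx Γ → Forces acc hwf w A.erase Γ →
        Foc acc hwf w Γ (.inv none A)) ∧
      (∀ Γ, StableCtx Γ → Neutral acc hwf w A Γ → Forces acc hwf w A.erase Γ)
  | .atom Q => by
    simp only [Neg.erase, Forces]
    exact ⟨fun Γ hΓ h => h, fun Γ hΓ h => h Γ (.refl hΓ w) _ (.atom Q) .atomL⟩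
  | .up A => by
    have ih := Pos.reify_reflect above A
    simp only [Neg.erase]
    refine ⟨fun Γ hΓ h => ih.1 Γ hΓ h _ (.up A) Γ (.refl hΓ w) fun _ _ h' => .upR h',
      fun Γ hΓ h => .of_cover above hΓ fun C hC Γ' ext k => ?_⟩
    exact h Γ' ext C hC (.upL (ih.2 Γ' ext.stable C k))
  | .imp A B => by
    have ihA := Pos.reify_reflect above A
    have ihB := Neg.reify_reflect above B
    simp only [Neg.erase, Forces]
    refine ⟨fun Γ hΓ h => .impR (ihA.2 Γ hΓ B fun Γ' ext hA => ihB.1 Γ' ext.stable (h Γ' ext hA)),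
      fun Γ hΓ h Γ' ext hA => .of_cover above ext.stable ?_⟩
    -- Reifying the argument gives a right focus on `A` only under a cover. It is weakened to the
    -- context where a left focus on `B` is supplied, and `impL` combines the two.
    refine (ihA.1 Γ' ext.stable hA).bind fun Γ₁ ext₁ hA₁ => .pure fun Γ₂ ext₂ => ?_
    refine ihB.2 Γ₂ ext₂.stable fun Γ₃ ext₃ C hC hB => ?_
    exact h Γ₃ (((ext.trans ext₁).trans ext₂).trans ext₃) C hC
      (.impL .refl (hA₁.weaken above ext₁.stable trivial (ext₂.trans ext₃)) hB)
end

theorem focusingAt (hwf : WellFounded fun u v => acc v u) (w : W) : FocusingAt P N acc hwf w := by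
  induction w using (wf_transGen hwf).induction with
  | _ w above =>
  intro Γ hΓ C
  refine ⟨fun h => h.sound_of_above above hΓ (.refl _ _) fun A hA => .hyp hA, fun h => ?_⟩
  refine (C.reify_reflect above).1 Γ hΓ (h.forces above hΓ (.refl _ _) fun B hB => ?_)
  -- The identity environment: by stability each hypothesis at `w` is an atom, forced by membership,
  -- or a shifted negative, on which `downL` may focus and which is forced by reflection.
  obtain ⟨⟨A, v⟩, hA, hAB⟩ := List.mem_map.1 hB
  cases hAB
  cases hΓ A _ hA with
  | atom Q =>
    simp only [Pos.erase, Forces]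
    exact .pure fun Γ' ext => ext.sub _ hA
  | down A =>
    simp only [Pos.erase]
    exact (A.reify_reflect above).2 Γ hΓ (.of_mem hA)

end Focusing

end CPL

theorem theorem5 {P N W : Type*} (acc : W → W → Prop)
    (hwf : WellFounded fun u v : W => acc v u)
    (Γ : List (CPL.Form P N × W)) (A : CPL.Form P N) (w : W) :
    CPL.ND acc hwf w Γ A ↔
      CPL.Foc acc hwf w (CPL.polCtx Γ) (CPL.Goal.inv none A.toNeg) := by
  rw [CPL.focusingAt hwf w _ (CPL.stableCtx_polCtx Γ), CPL.eraseCtx_polCtx, A.erase_polarize.2]
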